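/- Let $\mathbb{F}_q$ be the finite field with $q$ elements, let $n\ge 1$, let $w_0,\dots,w_n$ be positive integers, and let $\mathbb{P}_{\mathbf w}=\mathbb{P}(w_0,\dots,w_n)$ be the weighted projective space over $\mathbb{F}_q$, whose geometric points are the classes $[x_0:\cdots:x_n]$ of nonzero vectors over $\overline{\mathbb{F}}_q$ modulo $(x_0,\dots,x_n)\sim(\lambda^{w_0}x_0,\dots,\lambda^{w_n}x_n)$, $\lambda\in\overline{\mathbb{F}}_q^{\times}$. Let $F\in\mathbb{F}_q[x_0,\dots,x_n]$ be nonzero and weighted homogeneous of degree $d\ge 1$, where $\deg x_i=w_i$. Let $X=V(F)\subset\mathbb{P}_{\mathbf w}$, let $X(\mathbb{F}_q)$ be the set of its $\mathbb{F}_q$-rational points (the geometric points of $X$ fixed by the Galois group of $\overline{\mathbb{F}}_q/\mathbb{F}_q$), let $N(F)$ be the set of zeros of $F$ in $\mathbb{F}_q^{n+1}$, and put $$\mu=\left\lceil\frac{\sum_{i=0}^n w_i-d}{d}\right\rceil ,$$ where $\lceil x\rceil$ is the smallest integer $\ge x$. (i) If all the variables $x_0,\dots,x_n$ occur in $F$,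 then $|N(F)|\equiv 0 \pmod{q^{\mu}}$. (ii) If $\mu\ge 1$, if $X$ lies in none of the coordinate hyperplanes $\{x_i=0\}=\mathbb{P}(w_0,\dots,\widehat{w_i},\dots,w_n)$, $0\le i\le n$, and if every variable $x_i$ that does not occur in $F$ has weight $w_i\le d$ (in particular, if all the variables occur in $F$), then $|X(\mathbb{F}_q)|\equiv 1+q+\cdots+q^{\mu-1}\pmod{q^{\mu}}$. (iii) If $d<\sum_{i=0}^n w_i\le 2d$, then $|X(\mathbb{F}_q)|\equiv 1\pmod q$. -/

import Mathlib

namespace WeightedProjective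

/-- Two nonzero vectors `x`, `y` of `K ^ ι` are equivalent when
`y i = c ^ (w i) * x i` for all `i` and some `c ∈ Kˣ`. -/
def setoid {ι : Type*} (K : Type*) [Field K] (w : ι → ℕ) :
    Setoid {x : ι → K // x ≠ 0} where
  r x y := ∃ c : Kˣ, ∀ i, y.1 i = (c : K) ^ w i * x.1 i
  iseqv :=
    { refl := fun x => ⟨1, fun i => by simp⟩
      symm := by
        rintro x y ⟨c, hc⟩
        refine ⟨c⁻¹, fun i => ?_⟩
        rw [hc i, ← mul_assoc, ← mul_pow]
        simp
      trans := by
        rintro x y z ⟨c, hc⟩ ⟨e, he⟩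
        refine ⟨e * c, fun i => ?_⟩
        rw [he i, hc i, Units.val_mul, mul_pow, mul_assoc] }

/-- The points over `K` of the quotient of `K ^ ι` minus the origin by the action of `Kˣ` with
weights `w`. For `K` algebraically closed these are the geometric points of the weighted
projective space with weights `w`. -/
def Space {ι : Type*} (K : Type*) [Field K] (w : ι → ℕ) : Type _ :=
  Quotient (setoid K w)

/-- The point with weighted homogeneous coordinates `x`. -/
def mk {ι : Type*} {K : Type*} [Field K] (w : ι → ℕ) (x : {x : ι → K // x ≠ 0}) : Space K w :=
  Quotient.mk (setoid K w) x

/-- A field automorphism of `K` over `k` applied to all the coordinates of a nonzero vector. -/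
def conjVec {ι k K : Type*} [Field k] [Field K] [Algebra k K] (σ : K ≃ₐ[k] K)
    (x : {x : ι → K // x ≠ 0}) : {x : ι → K // x ≠ 0} :=
  ⟨fun i => σ (x.1 i), fun h => x.2 (funext fun i => by simpa using congrFun h i)⟩

/-- The action of field automorphisms on the points of the weighted projective space,
`[x₀ : ⋯ : xₙ] ↦ [σ x₀ : ⋯ : σ xₙ]`. -/
def conj {ι k K : Type*} [Field k] [Field K] [Algebra k K] (w : ι → ℕ) (σ : K ≃ₐ[k] K) :
    Space K w → Space K w :=
  Quotient.map (conjVec σ) (by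
    rintro x y ⟨c, hc⟩
    refine ⟨Units.map (σ : K →* K) c, fun i => ?_⟩
    change σ (y.1 i) = (σ (c : K)) ^ w i * σ (x.1 i)
    rw [hc i, map_mul, map_pow])

open MvPolynomial in
/-- The zero locus `V(F)`, as a set of points of the weighted projective space over `K`, of a
weighted homogeneous polynomial `F` over `k`. -/
def zeroLocus {ι k : Type*} [Field k] (K : Type*) [Field K] [Algebra k K] (w : ι → ℕ)
    (F : MvPolynomial ι k) : Set (Space K w) :=
  {P | ∃ x : {x : ι → K // x ≠ 0}, mk w x = P ∧ aeval x.1 F = 0}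

open MvPolynomial in
/-- Whether a point lies on `V(F)` does not depend on the chosen coordinates. -/
theorem mk_mem_zeroLocus {ι k : Type*} [Field k] {K : Type*} [Field K] [Algebra k K]
    {w : ι → ℕ} {F : MvPolynomial ι k} {d : ℕ} (hF : IsWeightedHomogeneous w F d)
    (x : {x : ι → K // x ≠ 0}) : mk w x ∈ zeroLocus K w F ↔ aeval x.1 F = 0 := by
  refine ⟨?_, fun h => ⟨x, rfl, h⟩⟩
  rintro ⟨y, hy, h⟩
  obtain ⟨c, hc⟩ : ∃ c : Kˣ, ∀ i, x.1 i = (c : K) ^ w i * y.1 i := Quotient.exact hy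
  have key : aeval x.1 F = (c : K) ^ d * aeval y.1 F := by
    rw [aeval_def, aeval_def, eval₂_eq, eval₂_eq, Finset.mul_sum]
    refine Finset.sum_congr rfl fun m hm => ?_
    have hd := hF (mem_support_iff.1 hm)
    rw [Finsupp.weight_apply, Finsupp.sum] at hd
    have h1 : (c : K) ^ d = ∏ i ∈ m.support, ((c : K) ^ w i) ^ m i := by
      rw [← hd, ← Finset.prod_pow_eq_pow_sum]
      exact Finset.prod_congr rfl fun i _ => by rw [← pow_mul, smul_eq_mul, mul_comm]
    rw [h1, mul_left_comm, ← Finset.prod_mul_distrib]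
    congr 1
    exact Finset.prod_congr rfl fun i _ => by rw [hc i, mul_pow]
  rw [key, h, mul_zero]

/-- The set `V(F)(k)` of `k`-rational points of `V(F)` over a perfect field `k`: the geometric
points of `V(F)` that are fixed by all automorphisms of the algebraic closure over `k`. -/
def rationalPoints {ι k : Type*} [Field k] (w : ι → ℕ) (F : MvPolynomial ι k) :
    Set (Space (AlgebraicClosure k) w) :=
  {P | P ∈ zeroLocus (AlgebraicClosure k) w F ∧
    ∀ σ : AlgebraicClosure k ≃ₐ[k] AlgebraicClosure k, conj w σ P = P}

/-- `V(F)` lies in the `i`-th coordinate hyperplane `xᵢ = 0`, which is the weighted projective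
space with the weight `w i` omitted (containment of the sets of geometric points). -/
def LiesInCoordHyperplane {ι k : Type*} [Field k] (w : ι → ℕ) (F : MvPolynomial ι k) (i : ι) :
    Prop :=
  zeroLocus (AlgebraicClosure k) w F ⊆
    zeroLocus (AlgebraicClosure k) w (MvPolynomial.X i : MvPolynomial ι k)

/-- The number `μ = ⌈(∑ wᵢ - d) / d⌉`. -/
def mu {ι : Type*} [Fintype ι] (w : ι → ℕ) (d : ℕ) : ℕ :=
  ⌈((∑ i, (w i : ℚ)) - d) / d⌉₊

/-- No truncation takes place in `mu`: it is the ceiling in `ℤ`. -/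
theorem mu_eq {ι : Type*} [Fintype ι] [Nonempty ι] (w : ι → ℕ) (hw : ∀ i, 1 ≤ w i) (d : ℕ)
    (hd : 1 ≤ d) : (mu w d : ℤ) = ⌈((∑ i, (w i : ℚ)) - d) / d⌉ := by
  have hd' : (0 : ℚ) < d := by exact_mod_cast hd
  have hs : (0 : ℚ) < ∑ i, (w i : ℚ) :=
    Finset.sum_pos (fun i _ => by exact_mod_cast hw i) Finset.univ_nonempty
  have h : (-1 : ℚ) < ((∑ i, (w i : ℚ)) - d) / d := by
    rw [lt_div_iff₀ hd']
    linarith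
  have h0 : (0 : ℤ) ≤ ⌈((∑ i, (w i : ℚ)) - d) / d⌉ := by
    have : (-1 : ℤ) < ⌈((∑ i, (w i : ℚ)) - d) / d⌉ := Int.lt_ceil.2 (by exact_mod_cast h)
    omega
  rw [mu, ← Int.ceil_toNat, Int.toNat_of_nonneg h0]

end WeightedProjective

/-! This is Ax–Katz for weighted degrees. Lift `F` to the Witt vectors by Teichmüller
representatives and call the lift `G`. Modulo `p ^ N` with `N = f * e`, where `q = p ^ f`, the power
of `G` with exponent `p ^ N * (q - 1)` is the indicator of `F ≠ 0`. Expand its sum over all points.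
The character sums kill every term in which some variable has an exponent not divisible by `q - 1`.
In a surviving term, let `I` be the set of variables with nonzero exponent: each of the others
contributes a factor `q`, and `Nat.pow_dvd_multinomial` bounds the valuation of the multinomial
coefficient in terms of the weight of `I`. This proves
`MvPolynomial.IsWeightedHomogeneous.pow_dvd_card_eq_zero`, whose numerical condition holds with `e =
μ` as soon as all weights are at most `d`.

By `card_zeros_eq`, the number of zeros is `|X(𝔽_q)| (q - 1) + 1`, and `q - 1` is invertible modulo
`q ^ e`, so divisibility of the affine count becomes the projective congruence. -/

section

open Finset

/-! ### Digit sums and valuations of multinomial coefficients -/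

/-- The rotations of the base-`p` expansion of `j` folded to `f` digits. -/
theorem Nat.exists_digit_rotations {p : ℕ} (hp : 1 < p) (f : ℕ) (j : ℕ) :
    ∃ r : ℕ → ℕ, (∀ t, r (t + f) = r t) ∧ (∀ t, r t ≡ p ^ t * j [MOD p ^ f - 1]) ∧
      (j ≠ 0 → ∀ t, r t ≠ 0) ∧
      (p - 1) * ∑ t ∈ range f, r t = (p.digits j).sum * (p ^ f - 1) := by
  have hp0 : 0 < p := by omega
  induction j using Nat.strong_induction_on with
  | _ j ih =>
    rcases Nat.eq_zero_or_pos j with rfl | hj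
    · exact ⟨fun _ => 0, by simp, fun t => by simp [Nat.ModEq.refl], by simp, by simp⟩
    obtain ⟨r, hper, hmod, hne, hsum⟩ := ih (j / p) (Nat.div_lt_self hj hp)
    have hone : p ^ f ≡ 1 [MOD p ^ f - 1] :=
      ((Nat.modEq_iff_dvd' (Nat.one_le_pow _ _ hp0)).2 dvd_rfl).symm
    -- If `j = ∑ a_l p ^ l`, then `r t = ∑ a_l p ^ ((t + l) % f)`. Stripping the lowest digit shifts
    -- `t` by one, and over a full period each digit contributes `a_l (p ^ f - 1) / (p - 1)`.
    refine ⟨fun t => j % p * p ^ (t % f) + r (t + 1), fun t => ?_, fun t => ?_, fun _ t h => ?_, ?_⟩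
    · simp only [Nat.add_mod_right]
      rw [show t + f + 1 = t + 1 + f by ring, hper]
    · have h1 : p ^ (t % f) ≡ p ^ t [MOD p ^ f - 1] := by
        conv_rhs => rw [← Nat.mod_add_div t f, pow_add, pow_mul]
        simpa using ((Nat.ModEq.refl (p ^ (t % f))).mul (hone.pow (t / f))).symm
      have h2 := ((Nat.ModEq.refl (j % p)).mul h1).add (hmod (t + 1))
      refine h2.trans (congrArg (· % _) ?_)
      conv_rhs => rw [← Nat.mod_add_div j p]
      ring
    · simp only [Nat.add_eq_zero_iff, mul_eq_zero] at h
      have h3 : p ^ (t % f) ≠ 0 := by positivity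
      have h4 : j / p = 0 := by
        by_contra h4
        exact hne h4 _ h.2
      have := Nat.mod_add_div j p
      rw [h4] at this
      have h5 := h.1.resolve_right h3
      omega
    · have hshift : ∑ t ∈ range f, r (t + 1) = ∑ t ∈ range f, r t := by
        have h := Finset.sum_range_succ r f
        rw [Finset.sum_range_succ' r f, show r f = r 0 by simpa using hper 0] at h
        omega
      have hgeom : (p - 1) * ∑ t ∈ range f, p ^ (t % f) = p ^ f - 1 := by
        rw [Finset.sum_congr rfl fun t ht => by rw [Nat.mod_eq_of_lt (Finset.mem_range.1 ht)],
          mul_comm]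
        exact geom_sum_mul_of_one_le hp0 f
      rw [Nat.digits_def' hp hj, List.sum_cons, Finset.sum_add_distrib, ← Finset.mul_sum, hshift,
        mul_add, hsum, mul_left_comm, hgeom]
      ring

/-- A lower bound for the digit sums of exponents in a product of weighted monomials, all of the
same weight `d`, that is a `(p ^ f - 1)`-th power. -/
theorem Nat.mul_le_sum_digits_sum {p : ℕ} (hp : 1 < p) {f : ℕ} (hf : f ≠ 0) {σ ι : Type*}
    [Fintype ι] (S : Finset σ) (j : σ → ℕ) (m : σ → ι → ℕ) (w : ι → ℕ) (d : ℕ)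
    (hd : ∀ s ∈ S, ∑ i, w i * m s i = d) (hj : p ^ f - 1 ∣ ∑ s ∈ S, j s)
    (hm : ∀ i, p ^ f - 1 ∣ ∑ s ∈ S, j s * m s i) (e : ℕ)
    (he : ∀ c : ℕ, ∑ i with ∑ s ∈ S, j s * m s i ≠ 0, w i ≤ c * d → e ≤ c) :
    (p - 1) * (f * e) ≤ ∑ s ∈ S, (p.digits (j s)).sum := by
  have hQ : 0 < p ^ f - 1 := Nat.sub_pos_of_lt (Nat.one_lt_pow hf hp)
  choose r hper hmod hne hsum using fun s => Nat.exists_digit_rotations hp f (j s)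
  -- Rotation `t` replaces the exponents `j s` by `r s t`, which satisfy the same divisibilities. So
  -- the total exponent is `(p ^ f - 1) * c`, and comparing weights gives `w(I) ≤ c * d`, hence `e ≤
  -- c`.
  have key : ∀ t, (p ^ f - 1) * e ≤ ∑ s ∈ S, r s t := by
    intro t
    have h1 : p ^ f - 1 ∣ ∑ s ∈ S, r s t := by
      refine ((Nat.ModEq.sum fun s _ => hmod s t).dvd_iff dvd_rfl).2 ?_
      rw [← Finset.mul_sum]
      exact hj.mul_left _
    obtain ⟨c, hc⟩ := h1
    rw [hc]
    refine Nat.mul_le_mul_left _ (he c ?_)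
    -- A variable that occurs still occurs after rotation, and its exponent is a positive multiple
    -- of `p ^ f - 1`.
    have h2 : ∀ i, ∑ s ∈ S, j s * m s i ≠ 0 → p ^ f - 1 ≤ ∑ s ∈ S, r s t * m s i := by
      intro i hi
      refine Nat.le_of_dvd ?_ ?_
      · obtain ⟨s, hs, hsi⟩ := Finset.exists_ne_zero_of_sum_ne_zero hi
        refine Nat.pos_of_ne_zero fun h => ?_
        have := (Finset.sum_eq_zero_iff.1 h) s hs
        exact mul_ne_zero (hne s (left_ne_zero_of_mul hsi) t) (right_ne_zero_of_mul hsi) this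
      · refine ((Nat.ModEq.sum fun s _ => (hmod s t).mul_right (m s i)).dvd_iff dvd_rfl).2 ?_
        simp only [mul_assoc]
        rw [← Finset.mul_sum]
        exact (hm i).mul_left _
    refine Nat.le_of_mul_le_mul_left (c := p ^ f - 1) ?_ hQ
    calc (p ^ f - 1) * ∑ i with ∑ s ∈ S, j s * m s i ≠ 0, w i
        = ∑ i with ∑ s ∈ S, j s * m s i ≠ 0, w i * (p ^ f - 1) := by
          rw [Finset.mul_sum]; exact Finset.sum_congr rfl fun _ _ => mul_comm _ _
      _ ≤ ∑ i with ∑ s ∈ S, j s * m s i ≠ 0, w i * ∑ s ∈ S, r s t * m s i :=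
          Finset.sum_le_sum fun i hi => Nat.mul_le_mul_left _ (h2 i (Finset.mem_filter.1 hi).2)
      _ ≤ ∑ i, w i * ∑ s ∈ S, r s t * m s i :=
          Finset.sum_le_sum_of_subset (Finset.filter_subset _ _)
      _ = ∑ s ∈ S, r s t * ∑ i, w i * m s i := by
          simp only [Finset.mul_sum]
          rw [Finset.sum_comm]
          exact Finset.sum_congr rfl fun s _ => Finset.sum_congr rfl fun i _ => by ring
      _ = ∑ s ∈ S, r s t * d := Finset.sum_congr rfl fun s hs => by rw [hd s hs]
      _ = (p ^ f - 1) * (c * d) := by rw [← Finset.sum_mul, hc, mul_assoc]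
  refine Nat.le_of_mul_le_mul_left (c := p ^ f - 1) ?_ hQ
  calc (p ^ f - 1) * ((p - 1) * (f * e))
      = (p - 1) * ∑ t ∈ range f, (p ^ f - 1) * e := by
        rw [Finset.sum_const, Finset.card_range, smul_eq_mul]; ring
    _ ≤ (p - 1) * ∑ t ∈ range f, ∑ s ∈ S, r s t :=
        Nat.mul_le_mul_left _ (Finset.sum_le_sum fun t _ => key t)
    _ = ∑ s ∈ S, (p - 1) * ∑ t ∈ range f, r s t := by
        rw [Finset.sum_comm, Finset.mul_sum]
    _ = (p ^ f - 1) * ∑ s ∈ S, (p.digits (j s)).sum := by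
        rw [Finset.mul_sum]
        exact Finset.sum_congr rfl fun s _ => by rw [hsum, mul_comm]

/-- Legendre's formula for multinomial coefficients. -/
theorem Nat.sub_one_mul_padicValNat_multinomial {p : ℕ} [hp : Fact p.Prime] {σ : Type*}
    (S : Finset σ) (j : σ → ℕ) :
    (p - 1) * padicValNat p (Nat.multinomial S j) + (p.digits (∑ s ∈ S, j s)).sum =
      ∑ s ∈ S, (p.digits (j s)).sum := by
  classical
  have key : ∀ n : ℕ, (p - 1) * padicValNat p n.factorial + (p.digits n).sum = n := fun n => by
    rw [sub_one_mul_padicValNat_factorial, Nat.sub_add_cancel (Nat.digit_sum_le p n)]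
  have hprod : ∀ T : Finset σ, padicValNat p (∏ s ∈ T, (j s).factorial) =
      ∑ s ∈ T, padicValNat p (j s).factorial := fun T => by
    induction T using Finset.induction_on with
    | empty => simp
    | insert a T ha ih =>
      rw [Finset.prod_insert ha, Finset.sum_insert ha, padicValNat.mul (Nat.factorial_ne_zero _)
        (Finset.prod_ne_zero_iff.2 fun _ _ => Nat.factorial_ne_zero _), ih]
  have h1 := congrArg (padicValNat p) (Nat.multinomial_spec S j)
  rw [padicValNat.mul (Finset.prod_ne_zero_iff.2 fun _ _ => Nat.factorial_ne_zero _)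
    (Nat.multinomial_pos S j).ne', hprod] at h1
  have h2 := key (∑ s ∈ S, j s)
  have h3 : (p - 1) * ∑ s ∈ S, padicValNat p (j s).factorial + ∑ s ∈ S, (p.digits (j s)).sum =
      ∑ s ∈ S, j s := by
    rw [Finset.mul_sum, ← Finset.sum_add_distrib]
    exact Finset.sum_congr rfl fun s _ => key _
  rw [← h1, mul_add] at h2
  omega

theorem Nat.sum_digits_pow_mul_pow_sub_one_le {p : ℕ} (hp : 1 < p) (f N : ℕ) :
    (p.digits (p ^ N * (p ^ f - 1))).sum ≤ (p - 1) * f := by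
  rcases Nat.eq_zero_or_pos (p ^ f - 1) with h0 | h0
  · simp [h0]
  rw [Nat.digits_base_pow_mul hp h0, List.sum_append, List.sum_replicate, smul_zero, zero_add]
  have h1 : (p.digits (p ^ f - 1)).length ≤ f :=
    (Nat.digits_length_le_iff hp _).2 (Nat.sub_lt (by positivity) one_pos)
  have h2 : (p.digits (p ^ f - 1)).sum ≤ (p.digits (p ^ f - 1)).length • (p - 1) :=
    List.sum_le_card_nsmul _ _ fun x hx => Nat.le_sub_one_of_lt (Nat.digits_lt_base hp hx)
  refine h2.trans ?_
  rw [smul_eq_mul, mul_comm]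
  exact Nat.mul_le_mul_left _ h1

/-- A lower bound for the `p`-adic valuation of the multinomial coefficients in the expansion of
the power with exponent `p ^ N * (p ^ f - 1)` of a weighted homogeneous polynomial. -/
theorem Nat.pow_dvd_multinomial {p : ℕ} [hp : Fact p.Prime] {f : ℕ} (hf : f ≠ 0) (N : ℕ)
    {σ ι : Type*} [Fintype ι] (S : Finset σ) (j : σ → ℕ) (m : σ → ι → ℕ) (w : ι → ℕ) (d : ℕ)
    (hd : ∀ s ∈ S, ∑ i, w i * m s i = d) (hj : ∑ s ∈ S, j s = p ^ N * (p ^ f - 1))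
    (hm : ∀ i, p ^ f - 1 ∣ ∑ s ∈ S, j s * m s i) (e : ℕ)
    (he : ∀ c : ℕ, ∑ i with ∑ s ∈ S, j s * m s i ≠ 0, w i ≤ c * d → e ≤ c) :
    p ^ (f * (e - 1)) ∣ Nat.multinomial S j := by
  have hp1 := hp.out.one_lt
  rw [padicValNat_dvd_iff_le (Nat.multinomial_pos S j).ne']
  have h1 := Nat.mul_le_sum_digits_sum hp1 hf S j m w d hd (hj ▸ dvd_mul_left _ _) hm e he
  rw [← Nat.sub_one_mul_padicValNat_multinomial, hj] at h1
  have h2 := Nat.sum_digits_pow_mul_pow_sub_one_le hp1 f N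
  have h3 : (p - 1) * (f * e) ≤ (p - 1) * (padicValNat p (Nat.multinomial S j) + f) := by
    rw [mul_add]; omega
  have h4 := Nat.le_of_mul_le_mul_left h3 (by omega)
  rw [Nat.mul_sub, mul_one]
  omega

/-! ### Teichmüller lifts and the indicator of a nonzero residue -/

section Witt

open WittVector

variable {p : ℕ} [hp : Fact p.Prime] {k : Type*} [Field k] [CharP k p]

/-- Brings the valuation estimate back to ℕ: `p` is cancellable in the Witt vectors, and an integer
prime to `p` stays nonzero in the residue field. -/
theorem WittVector.natCast_pow_dvd_natCast_iff (e n : ℕ) :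
    (p : WittVector p k) ^ e ∣ (n : WittVector p k) ↔ p ^ e ∣ n := by
  refine ⟨fun h => ?_, fun h => by exact_mod_cast Nat.cast_dvd_cast (α := WittVector p k) h⟩
  rcases Nat.eq_zero_or_pos n with rfl | hn
  · exact dvd_zero _
  obtain ⟨v, n', hn', rfl⟩ := Nat.exists_eq_pow_mul_and_not_dvd hn.ne' p hp.out.ne_one
  rcases le_or_gt e v with hev | hev
  · exact (pow_dvd_pow p hev).mul_right _
  exfalso
  obtain ⟨s, rfl⟩ := Nat.exists_eq_add_of_lt hev
  have hp0 : (p : WittVector p k) ≠ 0 := p_nonzero p k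
  rw [add_assoc, pow_add, Nat.cast_mul, Nat.cast_pow] at h
  have h1 := (mul_dvd_mul_iff_left (pow_ne_zero v hp0)).1 h
  have h2 := map_dvd (constantCoeff : WittVector p k →+* k) ((dvd_pow_self _ (Nat.succ_ne_zero s)).trans h1)
  rw [map_natCast, map_natCast, CharP.cast_eq_zero, zero_dvd_iff, CharP.cast_eq_zero_iff k p] at h2
  exact hn' h2

variable [Fintype k]

/-- The sums of powers of the Teichmüller representatives vanish, like those of the elements
of a finite field. -/
theorem WittVector.sum_teichmuller_pow_of_not_dvd {a : ℕ} (ha : ¬ Fintype.card k - 1 ∣ a) :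
    ∑ x : k, teichmuller p x ^ a = 0 := by
  obtain ⟨u, hu⟩ : ∃ u : kˣ, u ^ a ≠ 1 := by
    by_contra! h
    exact ha ((FiniteField.forall_pow_eq_one_iff k a).1 h)
  have h1 : teichmuller p (u : k) ^ a ≠ 1 := fun h => hu <| by
    have h2 := congrArg (fun y : WittVector p k => y.coeff 0) h
    rw [← map_pow] at h2
    simp only [teichmuller_coeff_zero, one_coeff_zero] at h2
    exact Units.ext (by simpa using h2)
  have h2 : teichmuller p (u : k) ^ a * ∑ x : k, teichmuller p x ^ a =
      ∑ x : k, teichmuller p x ^ a := by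
    rw [Finset.mul_sum]
    refine Fintype.sum_equiv (Equiv.mulLeft₀ (u : k) u.ne_zero) _ _ fun x => ?_
    rw [← mul_pow, ← map_mul]
    rfl
  have h3 : (teichmuller p (u : k) ^ a - 1) * ∑ x : k, teichmuller p x ^ a = 0 := by
    rw [sub_mul, h2, one_mul, sub_self]
  exact (mul_eq_zero.1 h3).resolve_left (sub_ne_zero.2 h1)

/-- A multiple of `p` is raised to an exponent at least `N`. Otherwise `y ^ (q - 1) ≡ 1` modulo `p`,
and each further `p`-th power gains a factor `p`. -/
theorem WittVector.pow_dvd_pow_sub_ite [DecidableEq k] {f : ℕ} (hf : Fintype.card k = p ^ f)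
    (N : ℕ) (y : WittVector p k) :
    (p : WittVector p k) ^ N ∣
      y ^ (p ^ N * (p ^ f - 1)) - if constantCoeff y = 0 then 0 else 1 := by
  have hdvd : ∀ y : WittVector p k, constantCoeff y = 0 → (p : WittVector p k) ∣ y := fun y hy =>
    Ideal.mem_span_singleton.1 ((mem_span_p_iff_coeff_zero_eq_zero y).2 hy)
  have hq : 0 < p ^ f - 1 := by
    rw [← hf]
    exact Nat.sub_pos_of_lt Fintype.one_lt_card
  split_ifs with h
  · rw [sub_zero]
    refine (pow_dvd_pow_of_dvd (hdvd y h) N).trans (pow_dvd_pow y ?_)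
    exact (Nat.lt_pow_self hp.out.one_lt).le.trans (Nat.le_mul_of_pos_right _ hq)
  · have h1 : (p : WittVector p k) ∣ y ^ (p ^ f - 1) - 1 := hdvd _ <| by
      rw [map_sub, map_pow, map_one, ← hf, FiniteField.pow_card_sub_one_eq_one _ h, sub_self]
    have h2 := dvd_sub_pow_of_dvd_sub h1 N
    rw [one_pow, ← pow_mul, mul_comm] at h2
    exact (pow_dvd_pow _ N.le_succ).trans h2

end Witt

/-! ### Counting zeros in affine space -/

open MvPolynomial in
/-- The number of non-zeros of a weighted homogeneous polynomial over a field with `q` elements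
is divisible by `q ^ e`, provided that every set `I` of variables of total weight at most `c * d`
satisfies `e + 1 ≤ c + #Iᶜ`. -/
theorem MvPolynomial.IsWeightedHomogeneous.pow_dvd_card_ne_zero {ι k : Type*} [Fintype ι]
    [DecidableEq ι] [Field k] [Fintype k] [DecidableEq k] {w : ι → ℕ} {d e : ℕ}
    {F : MvPolynomial ι k} (hF : IsWeightedHomogeneous w F d)
    (he : ∀ (I : Finset ι) (c : ℕ), ∑ i ∈ I, w i ≤ c * d → e + 1 ≤ c + Iᶜ.card) :
    Fintype.card k ^ e ∣ Fintype.card {x : ι → k // eval x F ≠ 0} := by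
  classical
  obtain ⟨p, hchar, f, hp, hf⟩ := FiniteField.card' k
  have : Fact p.Prime := ⟨hp⟩
  rw [hf, ← pow_mul, ← WittVector.natCast_pow_dvd_natCast_iff (p := p) (k := k)]
  set N := (f : ℕ) * e with hN
  set M := p ^ N * (p ^ (f : ℕ) - 1) with hM
  set T := WittVector.teichmuller p (R := k) with hTdef
  let G : (ι → k) → WittVector p k := fun x => ∑ m ∈ F.support, T (coeff m F) * ∏ i, T (x i) ^ m i
  have hG : ∀ x, WittVector.constantCoeff (G x) = eval x F := fun x => by
    have hT : ∀ a : k, WittVector.constantCoeff (T a) = a := WittVector.teichmuller_coeff_zero p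
    simp only [G, map_sum, map_mul, map_prod, map_pow, hT, eval_eq']
  have hcard : (p : WittVector p k) ^ N ∣
      ∑ x, G x ^ M - ((Fintype.card {x : ι → k // eval x F ≠ 0} : ℕ) : WittVector p k) := by
    rw [Fintype.card_subtype, Finset.card_filter, Nat.cast_sum, ← Finset.sum_sub_distrib]
    refine Finset.dvd_sum fun x _ => ?_
    have := WittVector.pow_dvd_pow_sub_ite hf N (G x)
    rw [hG] at this
    by_cases h : eval x F = 0 <;> simpa [h, hM] using this
  refine (dvd_iff_dvd_of_dvd_sub hcard).1 ?_
  have hexpand : ∑ x, G x ^ M = ∑ j ∈ piAntidiag F.support M,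
      Nat.multinomial F.support j * (∏ m ∈ F.support, T (coeff m F) ^ j m) *
        ∏ i, ∑ t : k, T t ^ (∑ m ∈ F.support, j m * m i) := by
    simp only [G, Finset.sum_pow_eq_sum_piAntidiag]
    rw [Finset.sum_comm]
    refine Finset.sum_congr rfl fun j _ => ?_
    rw [Finset.prod_univ_sum, Fintype.piFinset_univ, Finset.mul_sum]
    refine Finset.sum_congr rfl fun x _ => ?_
    rw [mul_assoc]
    congr 1
    simp only [mul_pow, Finset.prod_mul_distrib, ← Finset.prod_pow, ← pow_mul,
      ← Finset.prod_pow_eq_pow_sum]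
    congr 1
    rw [Finset.prod_comm]
    exact Finset.prod_congr rfl fun i _ => Finset.prod_congr rfl fun m _ => by rw [mul_comm]
  rw [hexpand]
  refine Finset.dvd_sum fun j hj => ?_
  by_cases hdiv : ∀ i, p ^ (f : ℕ) - 1 ∣ ∑ m ∈ F.support, j m * m i
  swap
  · push Not at hdiv
    obtain ⟨i, hi⟩ := hdiv
    rw [← hf] at hi
    rw [Finset.prod_eq_zero (Finset.mem_univ i) (WittVector.sum_teichmuller_pow_of_not_dvd hi),
      mul_zero]
    exact dvd_zero _
  set I : Finset ι := {i | ∑ m ∈ F.support, j m * m i ≠ 0} with hI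
  -- The subtraction truncates to `0` when `#Iᶜ > e`; the factors from `Iᶜ` then suffice on their
  -- own.
  have h1 : p ^ ((f : ℕ) * (e + 1 - Iᶜ.card - 1)) ∣ Nat.multinomial F.support j := by
    refine Nat.pow_dvd_multinomial f.ne_zero N F.support j (fun m i => m i) w d (fun m hm => ?_)
      (mem_piAntidiag.1 hj).1 hdiv _ fun c hc => ?_
    · have := hF (mem_support_iff.1 hm)
      rw [Finsupp.weight_apply, Finsupp.sum_fintype _ _ (by simp)] at this
      simpa [mul_comm] using this
    · have := he I c hc
      omega
  have h2 : (p : WittVector p k) ^ ((f : ℕ) * Iᶜ.card) ∣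
      ∏ i, ∑ t : k, T t ^ (∑ m ∈ F.support, j m * m i) := by
    refine Dvd.dvd.trans (Eq.dvd ?_) (Finset.prod_dvd_prod_of_subset Iᶜ _ _ (Finset.subset_univ _))
    rw [pow_mul, ← Finset.prod_const]
    refine Finset.prod_congr rfl fun i hi => ?_
    have hi0 : ∑ m ∈ F.support, j m * m i = 0 := by
      by_contra h
      exact Finset.mem_compl.1 hi (Finset.mem_filter.2 ⟨Finset.mem_univ _, h⟩)
    -- With exponent `0` every summand is `1`, also at `t = 0`, so the sum is `q`.
    simp [hi0, hf]
  have h3 := mul_dvd_mul ((WittVector.natCast_pow_dvd_natCast_iff (p := p) (k := k) _ _).2 h1) h2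
  rw [← pow_add, ← mul_add] at h3
  rw [mul_right_comm]
  refine (pow_dvd_pow _ ?_).trans (h3.mul_right _)
  rw [hN]
  exact Nat.mul_le_mul_left _ (by omega)

open MvPolynomial in
/-- The number of zeros of a weighted homogeneous polynomial over a field with `q` elements
is divisible by `q ^ e`, provided that every set `I` of variables of total weight at most `c * d`
satisfies `e + 1 ≤ c + #Iᶜ`. -/
theorem MvPolynomial.IsWeightedHomogeneous.pow_dvd_card_eq_zero {ι k : Type*} [Fintype ι]
    [DecidableEq ι] [Field k] [Finite k] {w : ι → ℕ} {d e : ℕ}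
    {F : MvPolynomial ι k} (hF : IsWeightedHomogeneous w F d)
    (he : ∀ (I : Finset ι) (c : ℕ), ∑ i ∈ I, w i ≤ c * d → e + 1 ≤ c + Iᶜ.card) :
    Nat.card k ^ e ∣ Nat.card {x : ι → k // eval x F = 0} := by
  classical
  have := Fintype.ofFinite k
  have h1 := hF.pow_dvd_card_ne_zero he
  have h2 := Fintype.card_subtype_compl (fun x : ι → k => eval x F = 0)
  have h3 := Fintype.card_subtype_le (fun x : ι → k => eval x F = 0)
  rw [Fintype.card_fun] at h2 h3
  rw [Nat.card_eq_fintype_card, Nat.card_eq_fintype_card]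
  refine (Nat.dvd_add_right h1).1 ?_
  rw [h2, Nat.sub_add_cancel h3]
  refine pow_dvd_pow _ ?_
  -- This case says `e + 1 ≤ #ι`, so `q ^ e` divides the number of all points.
  have := he ∅ 0 (by simp)
  simp only [compl_empty, card_univ] at this
  omega

/-! ### From rational points to affine zeros -/

/-- Bézout. With `H` trivial it gives injectivity, and with `H` the image of `kˣ` surjectivity, of
the parametrization in `nonempty_units_equiv_fiber`. -/
theorem Subgroup.pow_finset_gcd_mem {G ι : Type*} [CommGroup G] (H : Subgroup G) (c : G)
    (S : Finset ι) (w : ι → ℕ) (h : ∀ i ∈ S, c ^ w i ∈ H) : c ^ S.gcd w ∈ H := by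
  classical
  induction S using Finset.induction_on with
  | empty => simp
  | insert a S ha ih =>
    have h1 := h a (Finset.mem_insert_self a S)
    have h2 := ih fun i hi => h i (Finset.mem_insert_of_mem hi)
    rw [Finset.gcd_insert, ← zpow_natCast]
    change c ^ ((Nat.gcd (w a) (S.gcd w) : ℕ) : ℤ) ∈ H
    rw [Nat.gcd_eq_gcd_ab, zpow_add, zpow_mul, zpow_mul, zpow_natCast, zpow_natCast]
    exact H.mul_mem (H.zpow_mem h1 _) (H.zpow_mem h2 _)

/-- `X ^ q - X` already splits over `k` as the product of all `X - a`. -/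
theorem FiniteField.mem_range_algebraMap_of_pow_card_eq {k K : Type*} [Field k] [Fintype k]
    [Field K] [Algebra k K] {y : K} (hy : y ^ Fintype.card k = y) :
    y ∈ Set.range (algebraMap k K) := by
  classical
  have h1 : (∏ a : k, (Polynomial.X - Polynomial.C a)) =
      Polynomial.X ^ Fintype.card k - Polynomial.X := by
    have hdeg := FiniteField.X_pow_card_sub_X_natDegree_eq k (Fintype.one_lt_card (α := k))
    have hmonic : (Polynomial.X ^ Fintype.card k - Polynomial.X : Polynomial k).Monic :=
      Polynomial.monic_X_pow_sub (by
        rw [Polynomial.degree_X]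
        exact_mod_cast Fintype.one_lt_card (α := k))
    have h := Polynomial.prod_multiset_X_sub_C_of_monic_of_roots_card_eq hmonic (by
      rw [hdeg, FiniteField.roots_X_pow_card_sub_X]
      rfl)
    rw [FiniteField.roots_X_pow_card_sub_X] at h
    exact h
  have h2 := congrArg (Polynomial.aeval y) h1
  simp only [map_prod, map_sub, map_pow, Polynomial.aeval_X, Polynomial.aeval_C, hy, sub_self] at h2
  obtain ⟨a, -, ha⟩ := Finset.prod_eq_zero_iff.1 h2
  exact ⟨a, (sub_eq_zero.1 ha).symm⟩

namespace WeightedProjective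

variable {ι k : Type*} [Field k]

/-- A nonzero vector over `k` as a vector over an extension field. -/
def baseChange (K : Type*) [Field K] [Algebra k K] (x : {x : ι → k // x ≠ 0}) :
    {x : ι → K // x ≠ 0} :=
  ⟨fun i => algebraMap k K (x.1 i), fun h => x.2 (funext fun i => by simpa using congrFun h i)⟩

theorem mk_eq_mk {K : Type*} [Field K] {w : ι → ℕ} {x y : {x : ι → K // x ≠ 0}} :
    mk w x = mk w y ↔ ∃ c : Kˣ, ∀ i, y.1 i = (c : K) ^ w i * x.1 i :=
  ⟨fun h => Quotient.exact h, fun h => Quotient.sound h⟩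

theorem conj_mk_baseChange {K : Type*} [Field K] [Algebra k K] (w : ι → ℕ) (σ : K ≃ₐ[k] K)
    (x : {x : ι → k // x ≠ 0}) :
    conj w σ (mk w (baseChange K x)) = mk w (baseChange K x) := by
  refine congrArg (mk w) (Subtype.ext (funext fun i => ?_))
  exact σ.commutes (x.1 i)

theorem aeval_baseChange_eq_zero {K : Type*} [Field K] [Algebra k K] (F : MvPolynomial ι k)
    (x : {x : ι → k // x ≠ 0}) :
    MvPolynomial.aeval (baseChange K x).1 F = 0 ↔ MvPolynomial.eval x.1 F = 0 := by
  have h := MvPolynomial.aeval_algebraMap_apply K x.1 F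
  change MvPolynomial.aeval (algebraMap k K ∘ x.1) F = 0 ↔ _
  rw [h, map_eq_zero, ← MvPolynomial.coe_aeval_eq_eval]
  rfl

/-- A point of weighted projective space over the algebraic closure of a finite field that is
fixed by the Galois group has coordinates in the finite field. -/
theorem exists_mk_baseChange_eq [Finite k] (w : ι → ℕ)
    {P : Space (AlgebraicClosure k) w}
    (hP : ∀ σ : AlgebraicClosure k ≃ₐ[k] AlgebraicClosure k, conj w σ P = P) :
    ∃ x : {x : ι → k // x ≠ 0}, mk w (baseChange (AlgebraicClosure k) x) = P := by
  have := Fintype.ofFinite k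
  obtain ⟨x, rfl⟩ := Quotient.exists_rep P
  have hq : 0 < Fintype.card k - 1 := Nat.sub_pos_of_lt Fintype.one_lt_card
  obtain ⟨c, hc⟩ := mk_eq_mk.1
    (hP (FiniteField.frobeniusAlgEquivOfAlgebraic k (AlgebraicClosure k)))
  replace hc : ∀ i, x.1 i = (c : AlgebraicClosure k) ^ w i * x.1 i ^ Fintype.card k := hc
  -- Frobenius invariance gives `x i = c ^ w i * x i ^ q`. Rescaling by `b` with `b ^ (q - 1) = c`
  -- makes each coordinate `b ^ w i * x i` Frobenius-invariant.
  obtain ⟨b, hb⟩ := IsAlgClosed.exists_pow_nat_eq (c : AlgebraicClosure k) hq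
  have hb0 : b ≠ 0 := by
    rintro rfl
    rw [zero_pow hq.ne'] at hb
    exact c.ne_zero hb.symm
  have hbq : b ^ Fintype.card k = c * b := by
    rw [← hb, ← pow_succ, Nat.sub_add_cancel Fintype.one_lt_card.le]
  have hfix : ∀ i, (b ^ w i * x.1 i) ^ Fintype.card k = b ^ w i * x.1 i := fun i => by
    conv_rhs => rw [hc i]
    rw [mul_pow, ← pow_mul, mul_comm (w i), pow_mul, hbq, mul_pow]
    ring
  choose y hy using fun i => FiniteField.mem_range_algebraMap_of_pow_card_eq (k := k) (hfix i)
  have hy0 : y ≠ 0 := by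
    rintro rfl
    refine x.2 (funext fun i => ?_)
    have := hy i
    rw [Pi.zero_apply, map_zero] at this
    exact (mul_eq_zero.1 this.symm).resolve_left (pow_ne_zero _ hb0)
  exact ⟨⟨y, hy0⟩, (mk_eq_mk.2 ⟨Units.mk0 b hb0, hy⟩).symm⟩

/-- The set of rational coordinate vectors of a rational point is in bijection with `kˣ`. -/
theorem nonempty_units_equiv_fiber [Finite ι] {w : ι → ℕ} (hw : ∀ i, 1 ≤ w i)
    (x : {x : ι → k // x ≠ 0}) :
    Nonempty (kˣ ≃ {y : {y : ι → k // y ≠ 0} //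
      mk w (baseChange (AlgebraicClosure k) y) = mk w (baseChange (AlgebraicClosure k) x)}) := by
  classical
  have := Fintype.ofFinite ι
  set S : Finset ι := {i | x.1 i ≠ 0} with hS
  have hmem : ∀ i, i ∈ S ↔ x.1 i ≠ 0 := fun i => by simp [hS]
  have hne : S.Nonempty := by
    obtain ⟨i, hi⟩ := Function.ne_iff.1 x.2
    exact ⟨i, (hmem i).2 hi⟩
  -- Scaling by `u ^ w i` with `u` in `kˣ` need be neither free nor transitive on the fibre.
  -- Dividing the weights on the support of `x` by their gcd `g` repairs both: `c` carries `x` to a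
  -- rational vector exactly when `u = c ^ g` is rational.
  obtain ⟨v, hv, hv1⟩ := Finset.extract_gcd w hne
  set g := S.gcd w
  have hg : 0 < g := by
    obtain ⟨i, hi⟩ := hne
    refine Nat.pos_of_ne_zero fun h => ?_
    have := hv i hi
    rw [h, zero_mul] at this
    exact absurd (hw i) (by omega)
  let y : kˣ → {y : ι → k // y ≠ 0} := fun u => ⟨fun i => (u : k) ^ v i * x.1 i, fun h => by
    obtain ⟨i, hi⟩ := hne
    exact mul_ne_zero (pow_ne_zero _ u.ne_zero) ((hmem i).1 hi) (congrFun h i)⟩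
  have hy : ∀ u, mk w (baseChange (AlgebraicClosure k) (y u)) =
      mk w (baseChange (AlgebraicClosure k) x) := fun u => by
    obtain ⟨c, hc⟩ := IsAlgClosed.exists_pow_nat_eq (algebraMap k (AlgebraicClosure k) u) hg
    have hc0 : c ≠ 0 := by
      rintro rfl
      rw [zero_pow hg.ne'] at hc
      exact u.ne_zero ((map_eq_zero _).1 hc.symm)
    refine (mk_eq_mk.2 ⟨Units.mk0 c hc0, fun i => ?_⟩).symm
    change algebraMap k (AlgebraicClosure k) ((u : k) ^ v i * x.1 i) =
      c ^ w i * algebraMap k (AlgebraicClosure k) (x.1 i)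
    by_cases hi : x.1 i = 0
    · simp [hi]
    · rw [hv i ((hmem i).2 hi), pow_mul, hc, map_mul, map_pow]
  refine ⟨Equiv.ofBijective (fun u => ⟨y u, hy u⟩) ⟨fun u u' h => ?_, ?_⟩⟩
  · have h1 : ∀ i, (u : k) ^ v i * x.1 i = (u' : k) ^ v i * x.1 i := fun i =>
      congrFun (congrArg (fun z => z.1.1) h) i
    have h2 := Subgroup.pow_finset_gcd_mem ⊥ (u / u') S v fun i hi => by
      rw [Subgroup.mem_bot, div_pow, div_eq_one]
      exact Units.ext (by simpa using mul_right_cancel₀ ((hmem i).1 hi) (h1 i))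
    rwa [hv1, pow_one, Subgroup.mem_bot, div_eq_one] at h2
  · rintro ⟨z, hz⟩
    obtain ⟨c, hc⟩ := mk_eq_mk.1 hz.symm
    replace hc : ∀ i, algebraMap k (AlgebraicClosure k) (z.1 i) =
      (c : AlgebraicClosure k) ^ w i * algebraMap k (AlgebraicClosure k) (x.1 i) := hc
    have h1 := Subgroup.pow_finset_gcd_mem
        (Units.map (algebraMap k (AlgebraicClosure k) : k →* AlgebraicClosure k)).range c S w
        fun i hi => by
      have hx := (hmem i).1 hi
      have hx' : algebraMap k (AlgebraicClosure k) (x.1 i) ≠ 0 := (map_ne_zero _).2 hx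
      have hz0 : z.1 i ≠ 0 := fun h0 => by
        have := hc i
        rw [h0, map_zero] at this
        exact mul_ne_zero (pow_ne_zero _ c.ne_zero) hx' this.symm
      refine ⟨Units.mk0 (z.1 i / x.1 i) (div_ne_zero hz0 hx), Units.ext ?_⟩
      simp only [Units.coe_map, Units.val_mk0, MonoidHom.coe_coe, map_div₀, Units.val_pow_eq_pow_val]
      rw [hc i, mul_div_cancel_right₀ _ hx']
    obtain ⟨u, hu⟩ := h1
    replace hu : algebraMap k (AlgebraicClosure k) u = (c : AlgebraicClosure k) ^ g := by
      simpa using congrArg Units.val hu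
    refine ⟨u, Subtype.ext (Subtype.ext (funext fun i => ?_))⟩
    refine (algebraMap k (AlgebraicClosure k)).injective ?_
    rw [hc i]
    change algebraMap k (AlgebraicClosure k) ((u : k) ^ v i * x.1 i) = _
    by_cases hi : x.1 i = 0
    · simp [hi]
    · rw [hv i ((hmem i).2 hi), pow_mul, ← hu, map_mul, map_pow]

/-- The number of zeros of `F` over a finite field with `q` elements is one more than `q - 1` times
the number of rational points of `V(F)`. -/
theorem card_zeros_eq [Finite ι] [Finite k] {w : ι → ℕ} (hw : ∀ i, 1 ≤ w i) {d : ℕ} (hd : 1 ≤ d)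
    {F : MvPolynomial ι k} (hF : MvPolynomial.IsWeightedHomogeneous w F d) :
    Nat.card {x : ι → k // MvPolynomial.eval x F = 0} =
      (rationalPoints w F).ncard * (Nat.card k - 1) + 1 := by
  classical
  have := Fintype.ofFinite k
  have hiff : ∀ x : {x : ι → k // x ≠ 0}, MvPolynomial.eval x.1 F = 0 ↔
      mk w (baseChange (AlgebraicClosure k) x) ∈ rationalPoints w F := fun x => by
    rw [← aeval_baseChange_eq_zero (K := AlgebraicClosure k) F x, ← mk_mem_zeroLocus hF]
    exact ⟨fun h => ⟨h, fun σ => conj_mk_baseChange w σ x⟩, fun h => h.1⟩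
  have hfib : ∀ P : rationalPoints w F, Nonempty ({x : {x : ι → k // x ≠ 0} //
      mk w (baseChange (AlgebraicClosure k) x) = P.1} ≃ kˣ) := fun P => by
    obtain ⟨x, hx⟩ := exists_mk_baseChange_eq w P.2.2
    rw [← hx]
    exact (nonempty_units_equiv_fiber hw x).map Equiv.symm
  have h1 := Nat.card_congr ((Equiv.sigmaSubtypeFiberEquivSubtype
    (fun x : {x : ι → k // x ≠ 0} => mk w (baseChange (AlgebraicClosure k) x)) hiff).symm.trans
    ((Equiv.sigmaCongrRight fun P => (hfib P).some).trans (Equiv.sigmaEquivProd _ _)))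
  rw [Nat.card_prod, Nat.card_units] at h1
  -- Since `d ≥ 1`, the origin is a zero; it accounts for the `+ 1`.
  have h0 : MvPolynomial.constantCoeff F = 0 := by
    by_contra h
    have := hF (d := 0) h
    rw [map_zero] at this
    omega
  have h2 : {x : ι → k | MvPolynomial.eval x F = 0} =
      insert 0 {x : ι → k | x ≠ 0 ∧ MvPolynomial.eval x F = 0} := by
    ext x
    by_cases hx : x = 0 <;> simp [hx, h0]
  have h3 := Set.ncard_insert_of_notMem (a := (0 : ι → k))
    (s := {x : ι → k | x ≠ 0 ∧ MvPolynomial.eval x F = 0}) (by simp) (Set.toFinite _)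
  rw [← h2] at h3
  refine h3.trans ?_
  rw [← Nat.card_coe_set_eq (rationalPoints w F), ← h1]
  congr 1
  exact Nat.card_congr (Equiv.subtypeSubtypeEquivSubtypeInter _ _).symm

end WeightedProjective

/-! ### The numerical conditions and the congruences -/

theorem MvPolynomial.IsWeightedHomogeneous.le_of_mem_vars {ι R : Type*} [CommSemiring R]
    {w : ι → ℕ} {d : ℕ} {F : MvPolynomial ι R} (hF : IsWeightedHomogeneous w F d) {i : ι}
    (hi : i ∈ F.vars) : w i ≤ d := by
  obtain ⟨m, hm, him⟩ := (mem_vars_iff_mem_support i).1 hi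
  have h := hF (mem_support_iff.1 hm)
  rw [Finsupp.weight_apply, Finsupp.sum] at h
  rw [← h]
  refine le_trans ?_ (Finset.single_le_sum (f := fun i => m i • w i) (fun _ _ => Nat.zero_le _) him)
  exact Nat.le_mul_of_pos_left _ (Nat.pos_of_ne_zero (Finsupp.mem_support_iff.1 him))

/-- Each variable outside `I` adds at most `d`, so `∑ w i ≤ (c + #Iᶜ) * d`, while `μ + 1 = ⌈∑ w i /
d⌉`. -/
theorem WeightedProjective.mu_add_one_le {ι : Type*} [Fintype ι] [DecidableEq ι] [Nonempty ι]
    {w : ι → ℕ} (hw : ∀ i, 1 ≤ w i) {d : ℕ} (hd : 1 ≤ d) (hwd : ∀ i, w i ≤ d) (I : Finset ι)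
    (c : ℕ) (hc : ∑ i ∈ I, w i ≤ c * d) : mu w d + 1 ≤ c + Iᶜ.card := by
  have h1 : ∑ i, w i ≤ (c + Iᶜ.card) * d := by
    rw [← Finset.sum_add_sum_compl I w, add_mul]
    exact Nat.add_le_add hc (Finset.sum_le_card_nsmul _ _ _ fun i _ => hwd i)
  have h2 : 0 < ∑ i, w i := Finset.sum_pos (fun i _ => hw i) Finset.univ_nonempty
  obtain ⟨C, hC⟩ : ∃ C, c + Iᶜ.card = C + 1 := Nat.exists_eq_succ_of_ne_zero fun h => by
    rw [h, zero_mul] at h1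
    omega
  rw [hC] at h1 ⊢
  refine Nat.succ_le_succ (Nat.ceil_le.2 ?_)
  rw [div_le_iff₀ (by exact_mod_cast hd)]
  have h3 : (∑ i, (w i : ℚ)) ≤ (C + 1) * d := by exact_mod_cast h1
  linarith

/-- The congruence for the number of rational points that follows from a divisibility of the
number of zeros. -/
theorem WeightedProjective.ncard_rationalPoints_modEq {ι k : Type*} [Field k] [Finite ι] [Finite k]
    {w : ι → ℕ} (hw : ∀ i, 1 ≤ w i) {d : ℕ} (hd : 1 ≤ d) {F : MvPolynomial ι k}
    (hF : MvPolynomial.IsWeightedHomogeneous w F d) {e : ℕ}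
    (he : Nat.card k ^ e ∣ Nat.card {x : ι → k // MvPolynomial.eval x F = 0}) :
    (rationalPoints w F).ncard ≡ ∑ j ∈ range e, Nat.card k ^ j [MOD Nat.card k ^ e] := by
  have hq : 1 ≤ Nat.card k := Nat.card_pos
  rw [card_zeros_eq hw hd hF] at he
  have h1 : (∑ j ∈ range e, Nat.card k ^ j) * (Nat.card k - 1) + 1 = Nat.card k ^ e := by
    rw [geom_sum_mul_of_one_le hq, Nat.sub_add_cancel (Nat.one_le_pow _ _ hq)]
  have h2 : (rationalPoints w F).ncard * (Nat.card k - 1) + 1 ≡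
      (∑ j ∈ range e, Nat.card k ^ j) * (Nat.card k - 1) + 1 [MOD Nat.card k ^ e] := by
    rw [h1]
    exact (Nat.modEq_zero_iff_dvd.2 he).trans (Nat.modEq_zero_iff_dvd.2 dvd_rfl).symm
  refine Nat.ModEq.cancel_right_of_coprime ?_ (Nat.ModEq.add_right_cancel' 1 h2)
  refine Nat.Coprime.pow_left e ?_
  exact (Nat.coprime_self_sub_right hq).2 (Nat.coprime_one_right _)

end

theorem mainTheorem3 {k : Type*} [Field k] [Finite k] (q : ℕ) (hq : Nat.card k = q)
    (n : ℕ) (hn : 1 ≤ n) (w : Fin (n + 1) → ℕ) (hw : ∀ i, 1 ≤ w i)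
    (d : ℕ) (hd : 1 ≤ d) (F : MvPolynomial (Fin (n + 1)) k) (hF0 : F ≠ 0)
    (hF : MvPolynomial.IsWeightedHomogeneous w F d) :
    ((∀ i, i ∈ F.vars) →
      Nat.card {x : Fin (n + 1) → k // MvPolynomial.eval x F = 0} ≡ 0
        [MOD q ^ WeightedProjective.mu w d]) ∧
    (1 ≤ WeightedProjective.mu w d →
      (∀ i, ¬ WeightedProjective.LiesInCoordHyperplane w F i) →
      (∀ i, i ∉ F.vars → w i ≤ d) →
      (WeightedProjective.rationalPoints w F).ncard ≡
        ∑ j ∈ Finset.range (WeightedProjective.mu w d), q ^ j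
        [MOD q ^ WeightedProjective.mu w d]) ∧
    (d < ∑ i, w i → ∑ i, w i ≤ 2 * d →
      (WeightedProjective.rationalPoints w F).ncard ≡ 1 [MOD q]) := by
  subst hq
  have hdvd : (∀ i, w i ≤ d) → Nat.card k ^ WeightedProjective.mu w d ∣
      Nat.card {x : Fin (n + 1) → k // MvPolynomial.eval x F = 0} := fun hwd =>
    hF.pow_dvd_card_eq_zero (WeightedProjective.mu_add_one_le hw hd hwd)
  refine ⟨fun h => Nat.modEq_zero_iff_dvd.2 (hdvd fun i => hF.le_of_mem_vars (h i)),
    fun _ _ h => WeightedProjective.ncard_rationalPoints_modEq hw hd hF (hdvd fun i => ?_),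
    fun h _ => ?_⟩
  · by_cases hi : i ∈ F.vars
    · exact hF.le_of_mem_vars hi
    · exact h i hi
  · have key : Nat.card k ^ 1 ∣ Nat.card {x : Fin (n + 1) → k // MvPolynomial.eval x F = 0} := by
      -- A weight may exceed `d` here, so the condition is checked directly for `e = 1`. If it
      -- fails, either `Iᶜ` is empty and `c ≤ 1`, contradicting `d < ∑ w i`, or `c = 0` and `#Iᶜ =
      -- 1`; then `I` has weight `0`, so it is empty, contradicting `n ≥ 1`.
      refine hF.pow_dvd_card_eq_zero fun I c hc => ?_
      by_contra! hlt
      have hI := Finset.card_add_card_compl I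
      rw [Fintype.card_fin] at hI
      have h1 : I.card ≤ ∑ i ∈ I, w i := by
        simpa using Finset.card_nsmul_le_sum I w 1 fun i _ => hw i
      rcases Nat.eq_zero_or_pos Iᶜ.card with h0 | h0
      · rw [Finset.card_eq_zero, Finset.compl_eq_empty_iff] at h0
        subst h0
        have h2 : c * d ≤ 1 * d := Nat.mul_le_mul_right d (by omega)
        omega
      · obtain rfl : c = 0 := by omega
        omega
    simpa using WeightedProjective.ncard_rationalPoints_modEq hw hd hF key
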